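/- **Setting.** Let $\mathcal X$ be a finite non-empty set of states, write $\overline{\mathbb R}=\mathbb R\cup\{-\infty,+\infty\}$, with the convention $0\cdot(\pm\infty)=0$, and let $\Omega=\mathcal X^{\mathbb N_0}$ be the set of paths $\omega:\mathbb N_0\to\mathcal X$. Let $\mathcal T$ be a non-empty, closed and convex set of row-stochastic $\mathcal X\times\mathcal X$ matrices with separately specified rows: whenever $T_x\in\mathcal T$ for every $x\in\mathcal X$, there is a $T\in\mathcal T$ with $T(x,\cdot)=T_x(x,\cdot)$ for all $x\in\mathcal X$. For $f:\mathcal X\to\mathbb R\cup\{+\infty\}$ and $x\in\mathcal X$ let $$[\underline Tf](x)=\inf_{T\in\mathcal T}\sum_{y\in\mathcal X}T(x,y)f(y),\qquad [\overline Tf](x)=\sup_{T\in\mathcal T}\sum_{y\in\mathcal X}T(x,y)f(y).$$ **Game-theoretic expectations.** A situation is a finite string of states; $\Box$ is the empty string. The local model in a situation $s=x_0\cdots x_n$ is $\overline Q_s(f)=[\overline Tf](x_n)$. The local model $\overline Q_\Box$ is any map from the functions $\mathcal X\to\mathbb R\cup\{+\infty\}$ to $\mathbb R\cup\{+\infty\}$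 such that, for all $f,g:\mathcal X\to\mathbb R\cup\{+\infty\}$: $\overline Q_\Box(c)=c$ for $c\in\mathbb R$; $\overline Q_\Box(f+g)\le\overline Q_\Box(f)+\overline Q_\Box(g)$; $\overline Q_\Box(\lambda f)=\lambda\overline Q_\Box(f)$ for $\lambda\in(0,+\infty]$ and $f\ge0$; and $f\le g$ implies $\overline Q_\Box(f)\le\overline Q_\Box(g)$. A supermartingale is a map $\mathcal M$ from the situations to $\overline{\mathbb R}$ that is bounded below by a real constant and satisfies $\overline Q_s(\mathcal M(s\,\cdot))\le\mathcal M(s)$ for every situation $s$ (including $\Box$), where $\mathcal M(s\,\cdot)$ is the function $x\mapsto\mathcal M(sx)$. For $f:\Omega\to\overline{\mathbb R}$ and $x\in\mathcal X$, let $$\overline{\mathbb E}^{\mathrm V}_{\mathcal T}[f\mid X_0=x]=\inf\Bigl\{\mathcal M(x): \mathcal M\text{ a supermartingale with }\liminf_{m\to\infty}\mathcal M(\omega(0)\cdots\omega(m))\ge f(\omega)\text{ for all }\omega\in\Omega\text{ with }\omega(0)=x\Bigr\},$$ and $\underline{\mathbb E}^{\mathrm V}_{\mathcal T}[f\mid X_0=x]=-\overline{\mathbb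 E}^{\mathrm V}_{\mathcal T}[-f\mid X_0=x]$. **Proposition.** Let $A\subseteq\mathcal X$, with indicator $\mathbb I_A$, and let $G_A(\omega)=\sup_{t\in\mathbb N_0}\mathbb I_A(\omega(t))$ for $\omega\in\Omega$. Put $\underline p_A^{(0)}=\overline p_A^{(0)}=\mathbb I_A$ and, for $n\ge0$, $$\underline p_A^{(n+1)}=\mathbb I_A+\mathbb I_{A^c}\cdot\underline T\,\underline p_A^{(n)},\qquad \overline p_A^{(n+1)}=\mathbb I_A+\mathbb I_{A^c}\cdot\overline T\,\overline p_A^{(n)}.$$ Then both sequences converge pointwise on $\mathcal X$, and for every $x\in\mathcal X$ $$\underline{\mathbb E}^{\mathrm V}_{\mathcal T}[G_A\mid X_0=x]=\lim_{n\to\infty}\underline p_A^{(n)}(x),\qquad \overline{\mathbb E}^{\mathrm V}_{\mathcal T}[G_A\mid X_0=x]=\lim_{n\to\infty}\overline p_A^{(n)}(x).$$ -/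

import Mathlib

open Filter Topology

namespace ImpreciseMarkov

noncomputable section

variable {X : Type*}

/-! ### Sets of transition matrices and their transition operators -/

/-- A set of transition matrices has separately specified rows if rows chosen from arbitrary
members, one member for each state, can be combined into a member. -/
def SeparatelySpecifiedRows (𝒯 : Set (Matrix X X ℝ)) : Prop :=
  ∀ R : X → Matrix X X ℝ, (∀ x, R x ∈ 𝒯) → ∃ T ∈ 𝒯, ∀ x y, T x y = R x x y

/-- The standing assumptions on a set of transition (that is, row-stochastic) matrices. -/
structure IsTransitionSet [Fintype X] [DecidableEq X] (𝒯 : Set (Matrix X X ℝ)) : Prop where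
  stochastic : ∀ T ∈ 𝒯, T ∈ Matrix.rowStochastic ℝ X
  nonempty : 𝒯.Nonempty
  closed : IsClosed 𝒯
  convex : Convex ℝ 𝒯
  rows : SeparatelySpecifiedRows 𝒯

/-- `[T f](x) = ∑ y, T(x, y) f(y)` for `f` with values in `ℝ ∪ {+∞}`; in `EReal`, `0 * ⊤ = 0`. -/
def transApply [Fintype X] (T : Matrix X X ℝ) (f : X → EReal) (x : X) : EReal :=
  ∑ y, (T x y : EReal) * f y

/-- The lower transition operator. -/
def lowerTrans [Fintype X] (𝒯 : Set (Matrix X X ℝ)) (f : X → EReal) (x : X) : EReal :=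
  ⨅ T ∈ 𝒯, transApply T f x

/-- The upper transition operator. -/
def upperTrans [Fintype X] (𝒯 : Set (Matrix X X ℝ)) (f : X → EReal) (x : X) : EReal :=
  ⨆ T ∈ 𝒯, transApply T f x

/-! ### Game-theoretic upper and lower expectations

A situation is a finite list of states; the empty list is the initial situation `□`.
Functions with values in `ℝ ∪ {+∞}` are `EReal`-valued functions that avoid `⊥`. -/

/-- The axioms of a local uncertainty model `Q : (X → ℝ ∪ {+∞}) → ℝ ∪ {+∞}`. -/
structure IsLocalModel (Q : (X → EReal) → EReal) : Prop where
  ne_bot : ∀ f : X → EReal, (∀ x, f x ≠ ⊥) → Q f ≠ ⊥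
  const : ∀ c : ℝ, Q (fun _ => (c : EReal)) = (c : EReal)
  subadditive : ∀ f g : X → EReal, (∀ x, f x ≠ ⊥) → (∀ x, g x ≠ ⊥) →
    Q (fun x => f x + g x) ≤ Q f + Q g
  homogeneous : ∀ (c : EReal) (f : X → EReal), 0 < c → (∀ x, 0 ≤ f x) →
    Q (fun x => c * f x) = c * Q f
  monotone : ∀ f g : X → EReal, (∀ x, f x ≠ ⊥) → (∀ x, g x ≠ ⊥) →
    (∀ x, f x ≤ g x) → Q f ≤ Q g

/-- The first `n` states `ω 0, …, ω (n - 1)` of the path `ω`, as a situation. -/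
def pathPrefix (ω : ℕ → X) (n : ℕ) : List X := (List.range n).map ω

/-- Supermartingales for the family `Q` of local models: extended real-valued maps on all
situations, uniformly bounded below, with `Q_s(M(s ·)) ≤ M(s)` in every situation `s`. -/
structure IsSupermartingale (Q : List X → (X → EReal) → EReal) (M : List X → EReal) : Prop where
  bddBelow : ∃ c : ℝ, ∀ s, (c : EReal) ≤ M s
  step : ∀ s, Q s (fun x => M (s ++ [x])) ≤ M s

/-- The game-theoretic upper expectation of `f` conditional on the situation `s`: the infimum of
`M(s)` over the supermartingales `M` with `liminf M ≥ f` on all paths that start with `s`. -/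
def upperExp (Q : List X → (X → EReal) → EReal) (f : (ℕ → X) → EReal) (s : List X) : EReal :=
  sInf {a | ∃ M, IsSupermartingale Q M ∧
    (∀ ω : ℕ → X, pathPrefix ω s.length = s →
      f ω ≤ liminf (fun m => M (pathPrefix ω m)) atTop) ∧ a = M s}

/-- The conjugate game-theoretic lower expectation. -/
def lowerExp (Q : List X → (X → EReal) → EReal) (f : (ℕ → X) → EReal) (s : List X) : EReal :=
  -upperExp Q (fun ω => -f ω) s

/-- The local models of a game-theoretic imprecise Markov chain: `Q_□ = Q₀` is the initial model,
and `Q_{x_{0:n}}(f) = [T̄ f](x_n)`. -/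
def markovModel [Fintype X] (𝒯 : Set (Matrix X X ℝ)) (Q₀ : (X → EReal) → EReal)
    (s : List X) (f : X → EReal) : EReal :=
  match s.getLast? with
  | none => Q₀ f
  | some x => upperTrans 𝒯 f x

/-! ### Hitting probabilities -/

/-- `G_A(ω) = sup_t 𝕀_A(ω(t))`, the indicator of the event that `ω` visits `A`. -/
def hit (A : Set X) (ω : ℕ → X) : EReal := ⨆ t : ℕ, A.indicator (fun _ => 1) (ω t)

/-- The iteration `p ↦ 𝕀_A + 𝕀_{Aᶜ} · S p`, started from `𝕀_A`. -/
def hitIter (A : Set X) (S : (X → EReal) → X → EReal) : ℕ → X → EReal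
  | 0 => A.indicator (fun _ => 1)
  | n + 1 => fun x =>
      A.indicator (fun _ => 1) x + Aᶜ.indicator (fun _ => 1) x * S (hitIter A S n) x

end

end ImpreciseMarkov

/-!
The value iterates `p n` are nondecreasing and lie in `[0, 1]`, so they converge to `p = ⨆ n, p n`;
since the transition operators are nonexpansive and `X` is finite, the limit is a supersolution:
`S p ≤ p` off `A` (`hitLimit_supersolution`). It remains to identify `p` with the
game-theoretic expectations.

*Upper bounds for `upperExp`.* They come from explicit supermartingales (`stopped`), which are
frozen at a constant once `A` has been visited and otherwise depend on the current state and time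
only (`upperExp_le_of_stopped`). For the upper expectation of `hit A` the value before the visit is
`p`. For `-hit A` the limit `-p` would not do: along a path that avoids `A` it need not tend to `0`.
Instead, for each horizon `n`, the value at time `k` is `-p (n - k)`, which vanishes off `A` beyond
the horizon; the infimum over `n` gives the bound.

*Lower bounds for `upperExp`.* Let `M` be a supermartingale. Since an upper expectation dominates
the minimum, every situation other than the initial one has a child that does not increase `M`;
likewise, if `p` is a supersolution for the lower operator, it has one that does not increase
`M + p` (`exists_child`). Following such children gives a path along which the process stays below
its starting value. Hence a supermartingale dominates the minimum of
its target (`le_of_le_liminf`), and backward induction turns this into `p n ≤ M` for the target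
`hit A`. For the target `-hit A`, if `M + p` were negative at `x`, such a path would keep `M + p`
below a negative constant; as `M ≥ -1`, it could not enter `A`, where `p = 1`, so `liminf M < 0`
on a path where the target is `0`.
-/

open Filter Topology

namespace ImpreciseMarkov

noncomputable section

/-! ### Transition operators -/

section Operators

variable {X : Type*}

/-- The properties of the lower and the upper transition operator on which the convergence of the
value iteration rests: constants are preserved, and the operator is monotone and nonexpansive
(the two together are the second field). -/
structure IsNonexpansive (S : (X → EReal) → X → EReal) : Prop where
  const : ∀ (c : ℝ) x, S (fun _ => (c : EReal)) x = c
  le_add_const : ∀ (f g : X → EReal) (c : ℝ), (∀ y, f y ≤ g y + c) → ∀ x, S f x ≤ S g x + c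

theorem IsNonexpansive.mono {S : (X → EReal) → X → EReal} (hS : IsNonexpansive S)
    {f g : X → EReal} (h : ∀ y, f y ≤ g y) (x : X) : S f x ≤ S g x := by
  simpa using hS.le_add_const f g 0 (by simpa using h) x

variable [Fintype X]

theorem transApply_mono {T : Matrix X X ℝ} (hT : ∀ x y, 0 ≤ T x y) {f g : X → EReal}
    (h : ∀ y, f y ≤ g y) (x : X) : transApply T f x ≤ transApply T g x :=
  Finset.sum_le_sum fun y _ =>
    mul_le_mul_of_nonneg_left (h y) (EReal.coe_nonneg.2 (hT x y))

theorem transApply_add {T : Matrix X X ℝ} (hT : ∀ x y, 0 ≤ T x y) (f g : X → EReal) (x : X) :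
    transApply T (fun y => f y + g y) x = transApply T f x + transApply T g x := by
  unfold transApply
  rw [← Finset.sum_add_distrib]
  exact Finset.sum_congr rfl fun y _ =>
    EReal.left_distrib_of_nonneg_of_ne_top (EReal.coe_nonneg.2 (hT x y)) (EReal.coe_ne_top _) _ _

theorem transApply_coe (T : Matrix X X ℝ) (q : X → ℝ) (x : X) :
    transApply T (fun y => (q y : EReal)) x = ((∑ y, T x y * q y : ℝ) : EReal) := by
  unfold transApply
  have key : ∀ s : Finset X,
      ∑ y ∈ s, (T x y : EReal) * (q y : EReal) = ((∑ y ∈ s, T x y * q y : ℝ) : EReal) := by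
    intro s
    classical
    induction s using Finset.induction_on with
    | empty => simp
    | insert a s ha ih => rw [Finset.sum_insert ha, Finset.sum_insert ha, ih]; push_cast; rfl
  exact key _

variable {𝒯 : Set (Matrix X X ℝ)}

theorem transApply_le_upperTrans {T : Matrix X X ℝ} (hT : T ∈ 𝒯) (f : X → EReal) (x : X) :
    transApply T f x ≤ upperTrans 𝒯 f x :=
  le_iSup₂ (f := fun T (_ : T ∈ 𝒯) => transApply T f x) T hT

theorem lowerTrans_le_transApply {T : Matrix X X ℝ} (hT : T ∈ 𝒯) (f : X → EReal) (x : X) :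
    lowerTrans 𝒯 f x ≤ transApply T f x :=
  iInf₂_le (f := fun T (_ : T ∈ 𝒯) => transApply T f x) T hT

/-- One half of the conjugacy of the two operators. -/
theorem upperTrans_neg_le (q : X → ℝ) (x : X) :
    upperTrans 𝒯 (fun y => -(q y : EReal)) x ≤ -lowerTrans 𝒯 (fun y => (q y : EReal)) x := by
  refine iSup₂_le fun T hT => ?_
  have h : transApply T (fun y => -(q y : EReal)) x = -transApply T (fun y => (q y : EReal)) x := by
    have := transApply_coe T (fun y => -q y) x
    simp only [EReal.coe_neg] at this
    rw [this, transApply_coe]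
    simp
  rw [h]
  exact EReal.neg_le_neg_iff.2 (lowerTrans_le_transApply hT _ x)

variable [DecidableEq X]

theorem transApply_const {T : Matrix X X ℝ} (hT : T ∈ Matrix.rowStochastic ℝ X) (c : ℝ) (x : X) :
    transApply T (fun _ => (c : EReal)) x = c := by
  rw [transApply_coe, ← Finset.sum_mul, Matrix.sum_row_of_mem_rowStochastic hT, one_mul]

theorem IsTransitionSet.nonneg (h𝒯 : IsTransitionSet 𝒯) {T : Matrix X X ℝ} (hT : T ∈ 𝒯) (x y : X) :
    0 ≤ T x y :=
  Matrix.nonneg_of_mem_rowStochastic (h𝒯.stochastic T hT)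

theorem transApply_le_add_const (h𝒯 : IsTransitionSet 𝒯) {T : Matrix X X ℝ} (hT : T ∈ 𝒯)
    {f g : X → EReal} {c : ℝ} (h : ∀ y, f y ≤ g y + c) (x : X) :
    transApply T f x ≤ transApply T g x + c := by
  refine (transApply_mono (h𝒯.nonneg hT) h x).trans ?_
  rw [transApply_add (h𝒯.nonneg hT), transApply_const (h𝒯.stochastic T hT)]

theorem IsTransitionSet.isNonexpansive_upperTrans (h𝒯 : IsTransitionSet 𝒯) :
    IsNonexpansive (upperTrans 𝒯) where
  const c x := by
    obtain ⟨T, hT⟩ := h𝒯.nonempty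
    refine le_antisymm (iSup₂_le fun T hT => (transApply_const (h𝒯.stochastic T hT) c x).le) ?_
    exact (transApply_const (h𝒯.stochastic T hT) c x).ge.trans (transApply_le_upperTrans hT _ x)
  le_add_const f g c h x := iSup₂_le fun T hT =>
    (transApply_le_add_const h𝒯 hT h x).trans
      (add_le_add_left (transApply_le_upperTrans hT g x) _)

theorem IsTransitionSet.isNonexpansive_lowerTrans (h𝒯 : IsTransitionSet 𝒯) :
    IsNonexpansive (lowerTrans 𝒯) where
  const c x := by
    obtain ⟨T, hT⟩ := h𝒯.nonempty
    refine le_antisymm ?_ (le_iInf₂ fun T hT => (transApply_const (h𝒯.stochastic T hT) c x).ge)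
    exact (lowerTrans_le_transApply hT _ x).trans (transApply_const (h𝒯.stochastic T hT) c x).le
  le_add_const f g c h x := by
    have hc : lowerTrans 𝒯 f x - c ≤ lowerTrans 𝒯 g x := le_iInf₂ fun T hT =>
      EReal.sub_le_of_le_add
        ((lowerTrans_le_transApply hT f x).trans (transApply_le_add_const h𝒯 hT h x))
    exact (EReal.sub_le_iff_le_add (.inl (EReal.coe_ne_bot c)) (.inl (EReal.coe_ne_top c))).1 hc

end Operators

/-! ### The value iteration -/

section Iteration

variable {X : Type*} {A : Set X} {S : (X → EReal) → X → EReal}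

theorem hitIter_of_mem {x : X} (hx : x ∈ A) (n : ℕ) : hitIter A S n x = 1 := by
  cases n <;> simp [hitIter, hx]

theorem hitIter_zero_of_notMem {x : X} (hx : x ∉ A) : hitIter A S 0 x = 0 := by
  simp [hitIter, hx]

theorem hitIter_succ_of_notMem {x : X} (hx : x ∉ A) (n : ℕ) :
    hitIter A S (n + 1) x = S (hitIter A S n) x := by
  simp [hitIter, hx]

theorem hitIter_mem_Icc (hS : IsNonexpansive S) (n : ℕ) (x : X) :
    0 ≤ hitIter A S n x ∧ hitIter A S n x ≤ 1 := by
  induction n generalizing x with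
  | zero =>
    by_cases hx : x ∈ A
    · simp [hitIter_of_mem hx]
    · simp [hitIter_zero_of_notMem hx]
  | succ n ih =>
    by_cases hx : x ∈ A
    · simp [hitIter_of_mem hx]
    · rw [hitIter_succ_of_notMem hx]
      constructor
      · simpa using (hS.const 0 x).ge.trans (hS.mono (by simpa using fun y => (ih y).1) x)
      · simpa using (hS.mono (by simpa using fun y => (ih y).2) x).trans (hS.const 1 x).le

theorem hitIter_monotone (hS : IsNonexpansive S) (x : X) :
    Monotone fun n => hitIter A S n x := by
  refine monotone_nat_of_le_succ fun n => ?_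
  induction n generalizing x with
  | zero =>
    by_cases hx : x ∈ A
    · simp [hitIter_of_mem hx]
    · rw [hitIter_zero_of_notMem hx]
      exact (hitIter_mem_Icc hS _ x).1
  | succ n ih =>
    by_cases hx : x ∈ A
    · simp [hitIter_of_mem hx]
    · rw [hitIter_succ_of_notMem hx, hitIter_succ_of_notMem hx]
      exact hS.mono ih x

/-- The limit of the value iteration. -/
def hitLimit (A : Set X) (S : (X → EReal) → X → EReal) (x : X) : EReal := ⨆ n, hitIter A S n x

theorem hitIter_le_hitLimit (n : ℕ) (x : X) : hitIter A S n x ≤ hitLimit A S x :=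
  le_iSup (fun n => hitIter A S n x) n

theorem hitLimit_of_mem {x : X} (hx : x ∈ A) : hitLimit A S x = 1 := by
  simp [hitLimit, hitIter_of_mem hx]

theorem hitLimit_nonneg (hS : IsNonexpansive S) (x : X) : 0 ≤ hitLimit A S x :=
  (hitIter_mem_Icc hS 0 x).1.trans (hitIter_le_hitLimit 0 x)

theorem hitLimit_le_one (hS : IsNonexpansive S) (x : X) : hitLimit A S x ≤ 1 :=
  iSup_le fun n => (hitIter_mem_Icc hS n x).2

theorem tendsto_hitIter (hS : IsNonexpansive S) :
    Tendsto (fun n => hitIter A S n) atTop (𝓝 (hitLimit A S)) :=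
  tendsto_pi_nhds.2 fun x => tendsto_atTop_iSup (hitIter_monotone hS x)

/-- On a finite state space the convergence is uniform, so that a nonexpansive operator can be
compared with its values on the iterates. -/
theorem hitLimit_supersolution [Finite X] (hS : IsNonexpansive S) {x : X} (hx : x ∉ A) :
    S (hitLimit A S) x ≤ hitLimit A S x := by
  have hbot : hitLimit A S x ≠ ⊥ := ((EReal.bot_lt_zero).trans_le (hitLimit_nonneg hS x)).ne'
  have htop : hitLimit A S x ≠ ⊤ := ((hitLimit_le_one hS x).trans_lt (by decide)).ne
  have step : ∀ ε : ℝ, 0 < ε → S (hitLimit A S) x ≤ hitLimit A S x + ε := by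
    intro ε hε
    have hev : ∀ᶠ n in atTop, ∀ y, hitLimit A S y ≤ hitIter A S n y + ε := by
      refine eventually_all.2 fun y => ?_
      have hlt : hitLimit A S y - ε < hitLimit A S y := by
        lift hitLimit A S y to ℝ using
          ⟨((hitLimit_le_one hS y).trans_lt (by decide)).ne,
            ((EReal.bot_lt_zero).trans_le (hitLimit_nonneg hS y)).ne'⟩ with r
        exact_mod_cast sub_lt_self r hε
      filter_upwards [(tendsto_pi_nhds.1 (tendsto_hitIter hS) y).eventually (lt_mem_nhds hlt)]
        with n hn
      exact (EReal.sub_le_iff_le_add (.inl (EReal.coe_ne_bot ε)) (.inl (EReal.coe_ne_top ε))).1 hn.le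
    obtain ⟨n, hn⟩ := hev.exists
    refine (hS.le_add_const _ _ ε hn x).trans (add_le_add_left ?_ _)
    rw [← hitIter_succ_of_notMem (S := S) hx]
    exact hitIter_le_hitLimit _ _
  lift hitLimit A S x to ℝ using ⟨htop, hbot⟩ with r
  refine le_of_forall_gt_imp_ge_of_dense fun b hb => ?_
  obtain ⟨z, hz, hzb⟩ := EReal.lt_iff_exists_real_btwn.1 hb
  have := step (z - r) (sub_pos.2 (EReal.coe_lt_coe_iff.1 hz))
  rw [← EReal.coe_add, add_sub_cancel] at this
  exact this.trans hzb.le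

end Iteration

/-! ### Paths and situations -/

section Paths

variable {X : Type*}

theorem pathPrefix_succ (ω : ℕ → X) (n : ℕ) : pathPrefix ω (n + 1) = pathPrefix ω n ++ [ω n] := by
  simp [pathPrefix, List.range_succ]

theorem apply_length_of_pathPrefix_eq {ω : ℕ → X} {s : List X} {x : X}
    (h : pathPrefix ω (s ++ [x]).length = s ++ [x]) : ω s.length = x := by
  rw [List.length_append, List.length_singleton, pathPrefix_succ] at h
  simpa using (List.append_inj' h rfl).2

theorem apply_zero_of_pathPrefix_eq {ω : ℕ → X} {s : List X} {x : X}
    (h : pathPrefix ω s.length = s) (hs : s.head? = some x) : ω 0 = x := by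
  cases s with
  | nil => simp at hs
  | cons y t =>
    simp only [pathPrefix, List.length_cons, List.range_succ_eq_map, List.map_cons,
      List.cons.injEq] at h
    simp only [List.head?_cons, Option.some.injEq] at hs
    rw [h.1, hs]

/-- A property of situations that some child always inherits holds along a whole path. -/
theorem exists_path {P : List X → Prop} (hP : ∀ s, P s → ∃ y, P (s ++ [y])) {s : List X}
    (hs : P s) : ∃ ω : ℕ → X, pathPrefix ω s.length = s ∧
      ∀ k, P (pathPrefix ω (s.length + k)) := by
  choose next hnext using fun t : {t // P t} => hP t.1 t.2
  let u : ℕ → {t // P t} := fun n => Nat.rec ⟨s, hs⟩ (fun _ t => ⟨t.1 ++ [next t], hnext t⟩) n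
  let ω : ℕ → X := fun t => if h : t < s.length then s[t] else next (u (t - s.length))
  have h0 : pathPrefix ω s.length = s := by
    refine List.ext_getElem (by simp [pathPrefix]) fun i h1 h2 => ?_
    simp [pathPrefix, ω, h2]
  have hu : ∀ k, pathPrefix ω (s.length + k) = (u k).1 := by
    intro k
    induction k with
    | zero => exact h0
    | succ k ih =>
      rw [← add_assoc, pathPrefix_succ, ih]
      simp [ω, u]
  exact ⟨ω, h0, fun k => hu k ▸ (u k).2⟩

theorem hit_eq_one {A : Set X} {ω : ℕ → X} {t : ℕ} (h : ω t ∈ A) : hit A ω = 1 := by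
  refine le_antisymm (iSup_le fun t => ?_) ?_
  · exact Set.indicator_apply_le' (fun _ => le_rfl) fun _ => zero_le_one
  · exact le_iSup_of_le t (by simp [h])

theorem hit_eq_zero {A : Set X} {ω : ℕ → X} (h : ∀ t, ω t ∉ A) : hit A ω = 0 := by
  simp [hit, h]

end Paths

/-! ### Lower bounds for supermartingales -/

section LowerBounds

variable {X : Type*} [Fintype X] {𝒯 : Set (Matrix X X ℝ)}
  {Q₀ : (X → EReal) → EReal} {M : List X → EReal}

theorem markovModel_append (s : List X) (x : X) (f : X → EReal) :
    markovModel 𝒯 Q₀ (s ++ [x]) f = upperTrans 𝒯 f x := by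
  simp [markovModel]

theorem upperTrans_le_of_isSupermartingale (hM : IsSupermartingale (markovModel 𝒯 Q₀) M)
    (s : List X) (x : X) :
    upperTrans 𝒯 (fun y => M (s ++ [x] ++ [y])) x ≤ M (s ++ [x]) := by
  simpa only [markovModel_append] using hM.step (s ++ [x])

variable [DecidableEq X] [Nonempty X]

/-- If `p` is a supersolution for the lower operator at `x`, then some child does not increase
`M + p`: otherwise `M + p` would exceed a constant `c' > c` at all children, and
`T (M + p) ≤ M + T p` for every transition matrix `T` would give `M + p ≥ c'` at the parent. -/
theorem exists_child (h𝒯 : IsTransitionSet 𝒯) (hM : IsSupermartingale (markovModel 𝒯 Q₀) M)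
    {p : X → EReal} {s : List X} {x : X} (hp0 : 0 ≤ p x) (hp1 : p x ≤ 1)
    (hp : lowerTrans 𝒯 p x ≤ p x) {c : ℝ} (hc : M (s ++ [x]) + p x ≤ c) :
    ∃ y, M (s ++ [x] ++ [y]) + p y ≤ c := by
  obtain ⟨y₀, hy₀⟩ := Finite.exists_min fun y => M (s ++ [x] ++ [y]) + p y
  refine ⟨y₀, ?_⟩
  by_contra! hlt
  obtain ⟨c', hcc', hc'⟩ := EReal.lt_iff_exists_real_btwn.1 hlt
  have hT : ∀ T ∈ 𝒯, (c' : EReal) ≤ M (s ++ [x]) + transApply T p x := by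
    intro T hT
    calc (c' : EReal) = transApply T (fun _ => (c' : EReal)) x :=
          (transApply_const (h𝒯.stochastic T hT) c' x).symm
      _ ≤ transApply T (fun y => M (s ++ [x] ++ [y]) + p y) x :=
          transApply_mono (h𝒯.nonneg hT) (fun y => hc'.le.trans (hy₀ y)) x
      _ = transApply T (fun y => M (s ++ [x] ++ [y])) x + transApply T p x :=
          transApply_add (h𝒯.nonneg hT) _ _ x
      _ ≤ M (s ++ [x]) + transApply T p x := add_le_add_left
          ((transApply_le_upperTrans hT _ x).trans (upperTrans_le_of_isSupermartingale hM s x)) _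
  obtain ⟨b, hb⟩ := hM.bddBelow
  have hbot : M (s ++ [x]) ≠ ⊥ := ((EReal.bot_lt_coe b).trans_le (hb _)).ne'
  have htop : M (s ++ [x]) ≠ ⊤ := by
    intro h
    rw [h, EReal.top_add_of_ne_bot ((EReal.bot_lt_zero).trans_le hp0).ne'] at hc
    exact EReal.coe_ne_top c (top_le_iff.1 hc)
  lift M (s ++ [x]) to ℝ using ⟨htop, hbot⟩ with m
  have hlow : (c' : EReal) - m ≤ p x :=
    (le_iInf₂ fun T hT' => EReal.sub_le_of_le_add' (hT T hT')).trans hp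
  lift p x to ℝ using ⟨(hp1.trans_lt (by decide)).ne, ((EReal.bot_lt_zero).trans_le hp0).ne'⟩ with r
  norm_cast at hlow hc hcc'
  linarith

/-- A supermartingale dominates every lower bound of its inferior limits along the paths through
the current situation. -/
theorem le_of_le_liminf (h𝒯 : IsTransitionSet 𝒯) (hM : IsSupermartingale (markovModel 𝒯 Q₀) M)
    {s : List X} {x : X} {a : EReal}
    (h : ∀ ω : ℕ → X, pathPrefix ω (s ++ [x]).length = s ++ [x] →
      a ≤ liminf (fun m => M (pathPrefix ω m)) atTop) :
    a ≤ M (s ++ [x]) := by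
  by_contra! hlt
  obtain ⟨c, hc, hca⟩ := EReal.lt_iff_exists_real_btwn.1 hlt
  obtain ⟨ω, hω, hk⟩ := exists_path (P := fun t => (∃ r y, t = r ++ [y]) ∧ M t ≤ c)
    (fun t ⟨⟨r, y, ht⟩, hMt⟩ => by
      subst ht
      obtain ⟨z, hz⟩ := exists_child h𝒯 hM (p := fun _ => ((0 : ℝ) : EReal)) (s := r) (x := y)
        (by simp) (by simp) (h𝒯.isNonexpansive_lowerTrans.const 0 y).le (c := c) (by simpa using hMt)
      exact ⟨z, ⟨_, z, rfl⟩, by simpa using hz⟩) (s := s ++ [x]) ⟨⟨s, x, rfl⟩, hc.le⟩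
  refine absurd ((h ω hω).trans (liminf_le_of_frequently_le' (Eventually.frequently ?_))) hca.not_ge
  filter_upwards [eventually_ge_atTop (s ++ [x]).length] with m hm
  obtain ⟨k, rfl⟩ := Nat.exists_eq_add_of_le hm
  exact (hk k).2

end LowerBounds

/-! ### Supermartingales stopped at the first visit -/

section Stopped

variable {X : Type*}

open Classical in
/-- The process with value `b` in the initial situation, value `a` in the situations that have
visited `A`, and value `h k x` in the other situations of length `k` with last state `x`. -/
def stopped (A : Set X) (a b : EReal) (h : ℕ → X → EReal) (s : List X) : EReal :=
  match s.getLast? with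
  | none => b
  | some x => if ∃ y ∈ s, y ∈ A then a else h s.length x

variable {A : Set X} {a b : EReal} {h : ℕ → X → EReal}

theorem stopped_of_visited {s : List X} {y : X} (hys : y ∈ s) (hy : y ∈ A) :
    stopped A a b h s = a := by
  unfold stopped
  split
  · next heq => simp [List.getLast?_eq_none_iff.1 heq] at hys
  · exact if_pos ⟨y, hys, hy⟩

/-- If `h` equals `a` on `A`, the process has the value given by `h` already when `A` is first
entered. -/
theorem stopped_append_of_not_visited (ha : ∀ k, ∀ y ∈ A, h k y = a) {s : List X}
    (hs : ∀ y ∈ s, y ∉ A) (x : X) : stopped A a b h (s ++ [x]) = h (s.length + 1) x := by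
  by_cases hx : x ∈ A
  · rw [stopped_of_visited (y := x) (by simp) hx, ha _ x hx]
  · have : ¬ ∃ y ∈ s ++ [x], y ∈ A := by
      rintro ⟨y, hy, hyA⟩
      rcases List.mem_append.1 hy with hy | hy
      · exact hs y hy hyA
      · exact hx (List.mem_singleton.1 hy ▸ hyA)
    simp only [stopped, List.getLast?_append, List.getLast?_singleton, Option.some_or, if_neg this]
    simp

variable [Fintype X] [DecidableEq X] {𝒯 : Set (Matrix X X ℝ)} {Q₀ : (X → EReal) → EReal}

theorem isSupermartingale_stopped (h𝒯 : IsTransitionSet 𝒯) (hQ₀ : IsLocalModel Q₀) {a b l : ℝ}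
    (hl : ∀ k x, (l : EReal) ≤ h k x) (hla : l ≤ a) (hlb : l ≤ b)
    (hb : ∀ k x, h k x ≤ b)
    (ha : ∀ k, ∀ y ∈ A, h k y = a)
    (hstep : ∀ k, ∀ x ∉ A, upperTrans 𝒯 (h (k + 2)) x ≤ h (k + 1) x) :
    IsSupermartingale (markovModel 𝒯 Q₀) (stopped A a b h) := by
  have hlow : ∀ s, (l : EReal) ≤ stopped A a b h s := by
    intro s
    unfold stopped
    split
    · exact_mod_cast hlb
    · split_ifs
      · exact_mod_cast hla
      · exact hl _ _
  refine ⟨⟨l, hlow⟩, fun s => ?_⟩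
  rcases List.eq_nil_or_concat' s with rfl | ⟨s, x, rfl⟩
  · have hup : ∀ x, stopped A a b h ([] ++ [x]) ≤ b := fun x => by
      rw [stopped_append_of_not_visited ha (by simp)]
      exact hb _ _
    refine (hQ₀.monotone _ (fun _ => (b : EReal))
      (fun x => ((EReal.bot_lt_coe l).trans_le (hlow _)).ne') (fun _ => EReal.coe_ne_bot b) hup).trans ?_
    rw [hQ₀.const]
    simp [stopped]
  · rw [markovModel_append]
    by_cases hv : ∃ y ∈ s ++ [x], y ∈ A
    · obtain ⟨y, hy, hyA⟩ := hv
      rw [stopped_of_visited hy hyA]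
      simp only [stopped_of_visited (List.mem_append_left [_] hy) hyA]
      exact (h𝒯.isNonexpansive_upperTrans.const a x).le
    · push Not at hv
      rw [stopped_append_of_not_visited ha fun y hy => hv y (List.mem_append_left _ hy)]
      simp only [stopped_append_of_not_visited ha hv]
      simpa using hstep s.length x (hv x (by simp))

/-- An upper bound for the upper expectation of a gamble `f` with `f ≤ a` on the paths that visit
`A` and `f ≤ 0` on the others. Time is the length of the situation, which is `1` for `[x]`. -/
theorem upperExp_le_of_stopped (h𝒯 : IsTransitionSet 𝒯) (hQ₀ : IsLocalModel Q₀) {a b l : ℝ}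
    (hl : ∀ k x, (l : EReal) ≤ h k x) (hla : l ≤ a) (hlb : l ≤ b)
    (hb : ∀ k x, h k x ≤ b)
    (ha : ∀ k, ∀ y ∈ A, h k y = a)
    (hstep : ∀ k, ∀ x ∉ A, upperTrans 𝒯 (h (k + 2)) x ≤ h (k + 1) x)
    (hlim : ∀ᶠ k in atTop, ∀ x ∉ A, 0 ≤ h k x)
    {f : (ℕ → X) → EReal} (hfA : ∀ ω t, ω t ∈ A → f ω ≤ a) (hf : ∀ ω, (∀ t, ω t ∉ A) → f ω ≤ 0)
    (x : X) : upperExp (markovModel 𝒯 Q₀) f [x] ≤ h 1 x := by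
  refine sInf_le ⟨_, isSupermartingale_stopped h𝒯 hQ₀ hl hla hlb hb ha hstep, fun ω _ => ?_,
    (stopped_append_of_not_visited ha (s := []) (by simp) x).symm⟩
  by_cases hω : ∃ t, ω t ∈ A
  · obtain ⟨t, ht⟩ := hω
    refine (hfA ω t ht).trans (le_liminf_of_le (by isBoundedDefault) ?_)
    filter_upwards [eventually_gt_atTop t] with m hm
    have hmem : ω t ∈ pathPrefix ω m := List.mem_map.2 ⟨t, List.mem_range.2 hm, rfl⟩
    rw [stopped_of_visited hmem ht]
  · push Not at hω
    refine (hf ω hω).trans (le_liminf_of_le (by isBoundedDefault) ?_)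
    filter_upwards [hlim, eventually_gt_atTop 0] with m hm hpos
    obtain ⟨k, rfl⟩ := Nat.exists_eq_add_of_lt hpos
    rw [zero_add] at hm ⊢
    rw [pathPrefix_succ, stopped_append_of_not_visited ha]
    · simpa [pathPrefix] using hm _ (hω k)
    · intro y hy
      obtain ⟨t, -, rfl⟩ := List.mem_map.1 hy
      exact hω t

end Stopped

/-! ### Hitting probabilities -/

section Hitting

variable {X : Type*} [Fintype X] [DecidableEq X] {𝒯 : Set (Matrix X X ℝ)}
  {Q₀ : (X → EReal) → EReal} (A : Set X)

theorem upperExp_hit_le (h𝒯 : IsTransitionSet 𝒯) (hQ₀ : IsLocalModel Q₀) (x : X) :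
    upperExp (markovModel 𝒯 Q₀) (hit A) [x] ≤ hitLimit A (upperTrans 𝒯) x := by
  have hS := h𝒯.isNonexpansive_upperTrans
  refine upperExp_le_of_stopped (A := A) (h := fun _ => hitLimit A (upperTrans 𝒯)) (a := 1) (b := 1)
    (l := 0) h𝒯 hQ₀ (fun _ y => by simpa using hitLimit_nonneg hS y) zero_le_one zero_le_one
    (fun _ y => by simpa using hitLimit_le_one hS y) (fun _ y hy => by simpa using hitLimit_of_mem hy)
    (fun _ y hy => hitLimit_supersolution hS hy) (.of_forall fun _ y _ => hitLimit_nonneg hS y)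
    (fun ω t ht => by simp [hit_eq_one ht]) (fun ω hω => (hit_eq_zero hω).le) x

theorem upperExp_neg_hit_le (h𝒯 : IsTransitionSet 𝒯) (hQ₀ : IsLocalModel Q₀) (n : ℕ) (x : X) :
    upperExp (markovModel 𝒯 Q₀) (fun ω => -hit A ω) [x] ≤ -hitIter A (lowerTrans 𝒯) n x := by
  have hS := h𝒯.isNonexpansive_lowerTrans
  refine upperExp_le_of_stopped (A := A) (h := fun k y => -hitIter A (lowerTrans 𝒯) (n + 1 - k) y)
    (a := -1) (b := 0) (l := -1) h𝒯 hQ₀ (fun k y => ?_) le_rfl (by norm_num)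
    (fun k y => ?_) (fun k y hy => by simp [hitIter_of_mem hy]) (fun k y hy => ?_) ?_
    (fun ω t ht => by simp [hit_eq_one ht]) (fun ω hω => by simp [hit_eq_zero hω]) x
  · simpa using (hitIter_mem_Icc hS (n + 1 - k) y).2
  · simpa using (hitIter_mem_Icc hS (n + 1 - k) y).1
  · have hcoe : ∀ j z, ((hitIter A (lowerTrans 𝒯) j z).toReal : EReal) = hitIter A (lowerTrans 𝒯) j z :=
      fun j z => EReal.coe_toReal ((hitIter_mem_Icc hS j z).2.trans_lt (by decide)).ne
        ((EReal.bot_lt_zero).trans_le (hitIter_mem_Icc hS j z).1).ne'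
    have key := upperTrans_neg_le (𝒯 := 𝒯)
      (fun z => (hitIter A (lowerTrans 𝒯) (n + 1 - (k + 2)) z).toReal) y
    simp only [hcoe] at key
    refine key.trans (EReal.neg_le_neg_iff.2 ?_)
    change _ ≤ lowerTrans 𝒯 (hitIter A (lowerTrans 𝒯) (n + 1 - (k + 2))) y
    rw [← hitIter_succ_of_notMem (S := lowerTrans 𝒯) hy]
    -- Equality holds up to the horizon; beyond it, truncated subtraction makes the index grow.
    exact hitIter_monotone hS y (by omega)
  · filter_upwards [eventually_ge_atTop (n + 1)] with k hk y hy
    simp [Nat.sub_eq_zero_of_le hk, hitIter_zero_of_notMem hy]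

variable [Nonempty X]

theorem hitLimit_le_upperExp_hit (h𝒯 : IsTransitionSet 𝒯) (x : X) :
    hitLimit A (upperTrans 𝒯) x ≤ upperExp (markovModel 𝒯 Q₀) (hit A) [x] := by
  refine le_sInf ?_
  rintro _ ⟨M, hM, hlim, rfl⟩
  have hlim' : ∀ s : List X, s.head? = some x → ∀ ω, pathPrefix ω s.length = s →
      hit A ω ≤ liminf (fun m => M (pathPrefix ω m)) atTop := fun s hs ω hω =>
    hlim ω (by simpa [pathPrefix] using apply_zero_of_pathPrefix_eq hω hs)
  have hit_nonneg : ∀ ω : ℕ → X, 0 ≤ hit A ω := fun ω => by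
    by_cases hω : ∃ t, ω t ∈ A
    · simp [hit_eq_one hω.choose_spec]
    · push Not at hω
      exact (hit_eq_zero hω).ge
  have key : ∀ n (s : List X) z, (s ++ [z]).head? = some x →
      hitIter A (upperTrans 𝒯) n z ≤ M (s ++ [z]) := by
    intro n
    induction n with
    | zero =>
      intro s z hs
      refine le_of_le_liminf h𝒯 hM fun ω hω => le_trans ?_ (hlim' _ hs ω hω)
      by_cases hz : z ∈ A
      · rw [hitIter_of_mem hz, hit_eq_one (t := s.length)]
        rwa [apply_length_of_pathPrefix_eq hω]
      · rw [hitIter_zero_of_notMem hz]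
        exact hit_nonneg ω
    | succ n ih =>
      intro s z hs
      by_cases hz : z ∈ A
      · refine le_of_le_liminf h𝒯 hM fun ω hω => le_trans ?_ (hlim' _ hs ω hω)
        rw [hitIter_of_mem hz, hit_eq_one (t := s.length)]
        rwa [apply_length_of_pathPrefix_eq hω]
      · rw [hitIter_succ_of_notMem hz]
        refine le_trans ?_ (upperTrans_le_of_isSupermartingale hM s z)
        exact h𝒯.isNonexpansive_upperTrans.mono
          (fun y => ih (s ++ [z]) y (by rw [List.head?_append, hs]; rfl)) z
  exact iSup_le fun n => by simpa using key n [] x (by simp)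

theorem neg_hitLimit_le_upperExp_neg_hit (h𝒯 : IsTransitionSet 𝒯) (x : X) :
    -hitLimit A (lowerTrans 𝒯) x ≤ upperExp (markovModel 𝒯 Q₀) (fun ω => -hit A ω) [x] := by
  have hS := h𝒯.isNonexpansive_lowerTrans
  refine le_sInf ?_
  rintro _ ⟨M, hM, hlim, rfl⟩
  have hlim' : ∀ s : List X, s.head? = some x → ∀ ω, pathPrefix ω s.length = s →
      -hit A ω ≤ liminf (fun m => M (pathPrefix ω m)) atTop := fun s hs ω hω =>
    hlim ω (by simpa [pathPrefix] using apply_zero_of_pathPrefix_eq hω hs)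
  have hit_le_one : ∀ ω : ℕ → X, hit A ω ≤ 1 := fun ω =>
    iSup_le fun t => Set.indicator_apply_le' (fun _ => le_rfl) fun _ => zero_le_one
  have hneg_one : ∀ (s : List X) z, (s ++ [z]).head? = some x → -1 ≤ M (s ++ [z]) :=
    fun s z hs => le_of_le_liminf h𝒯 hM fun ω hω =>
      (EReal.neg_le_neg_iff.2 (hit_le_one ω)).trans (hlim' _ hs ω hω)
  set p := hitLimit A (lowerTrans 𝒯) with hp
  by_contra! hlt
  obtain ⟨c, hc0, hc⟩ : ∃ c : ℝ, c < 0 ∧ M [x] + p x ≤ c := by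
    have htop : p x ≠ ⊤ := ((hitLimit_le_one hS x).trans_lt (by decide)).ne
    have hbot : p x ≠ ⊥ := ((EReal.bot_lt_zero).trans_le (hitLimit_nonneg hS x)).ne'
    lift p x to ℝ using ⟨htop, hbot⟩ with r
    obtain ⟨d, hd, hdr⟩ := EReal.lt_iff_exists_real_btwn.1 hlt
    norm_cast at hdr
    refine ⟨d + r, by linarith, ?_⟩
    push_cast
    exact add_le_add_left hd.le _
  have hnotMem : ∀ (s : List X) z, (s ++ [z]).head? = some x → M (s ++ [z]) + p z ≤ c → z ∉ A := by
    intro s z hs hcz hz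
    rw [hp, hitLimit_of_mem hz] at hcz
    have h0 : ((-1 + 1 : ℝ) : EReal) ≤ c :=
      (add_le_add_left (by simpa using hneg_one s z hs) _).trans (by simpa using hcz)
    linarith [EReal.coe_le_coe_iff.1 h0]
  obtain ⟨ω, hω, hk⟩ := exists_path
    (P := fun t => ∃ r y, t = r ++ [y] ∧ t.head? = some x ∧ M t + p y ≤ c)
    (fun t ⟨r, y, ht, hx, hMt⟩ => by
      subst ht
      obtain ⟨z, hz⟩ := exists_child h𝒯 hM (hitLimit_nonneg hS y) (hitLimit_le_one hS y)
        (hitLimit_supersolution hS (hnotMem r y hx hMt)) hMt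
      exact ⟨z, _, z, rfl, by rw [List.head?_append, hx]; rfl, hz⟩)
    (s := [x]) ⟨[], x, rfl, rfl, hc⟩
  have havoid : ∀ t, ω t ∉ A := by
    intro t
    obtain ⟨r, y, hr, hx, hMr⟩ := hk t
    rw [List.length_singleton, Nat.add_comm 1 t, pathPrefix_succ] at hr hx hMr
    have hy : ω t = y := by simpa using (List.append_inj' hr rfl).2
    subst hy
    exact hnotMem _ _ hx hMr
  have hle : liminf (fun m => M (pathPrefix ω m)) atTop ≤ c := by
    refine liminf_le_of_frequently_le' (Eventually.frequently ?_)
    filter_upwards [eventually_ge_atTop 1] with m hm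
    obtain ⟨k, rfl⟩ := Nat.exists_eq_add_of_le hm
    obtain ⟨r, y, -, -, hMr⟩ := hk k
    exact (le_add_of_nonneg_right (hitLimit_nonneg hS y)).trans hMr
  have h0 : -hit A ω ≤ c := (hlim ω hω).trans hle
  rw [hit_eq_zero havoid, neg_zero] at h0
  exact absurd (EReal.coe_nonneg.1 h0) (not_le.2 hc0)

theorem upperExp_hit (h𝒯 : IsTransitionSet 𝒯) (hQ₀ : IsLocalModel Q₀) (x : X) :
    upperExp (markovModel 𝒯 Q₀) (hit A) [x] = hitLimit A (upperTrans 𝒯) x :=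
  (upperExp_hit_le A h𝒯 hQ₀ x).antisymm (hitLimit_le_upperExp_hit A h𝒯 x)

theorem lowerExp_hit (h𝒯 : IsTransitionSet 𝒯) (hQ₀ : IsLocalModel Q₀) (x : X) :
    lowerExp (markovModel 𝒯 Q₀) (hit A) [x] = hitLimit A (lowerTrans 𝒯) x := by
  refine le_antisymm (EReal.neg_le_of_neg_le (neg_hitLimit_le_upperExp_neg_hit A h𝒯 x)) ?_
  exact iSup_le fun n => EReal.le_neg_of_le_neg (upperExp_neg_hit_le A h𝒯 hQ₀ n x)

end Hitting

end

end ImpreciseMarkov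

theorem mainTheorem6 {X : Type*} [Fintype X] [DecidableEq X] [Nonempty X]
    (𝒯 : Set (Matrix X X ℝ)) (h𝒯 : ImpreciseMarkov.IsTransitionSet 𝒯)
    (Q₀ : (X → EReal) → EReal) (hQ₀ : ImpreciseMarkov.IsLocalModel Q₀) (A : Set X) :
    Tendsto (fun n => ImpreciseMarkov.hitIter A (ImpreciseMarkov.lowerTrans 𝒯) n) atTop
      (𝓝 (fun x => ImpreciseMarkov.lowerExp (ImpreciseMarkov.markovModel 𝒯 Q₀)
        (ImpreciseMarkov.hit A) [x])) ∧
    Tendsto (fun n => ImpreciseMarkov.hitIter A (ImpreciseMarkov.upperTrans 𝒯) n) atTop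
      (𝓝 (fun x => ImpreciseMarkov.upperExp (ImpreciseMarkov.markovModel 𝒯 Q₀)
        (ImpreciseMarkov.hit A) [x])) := by
  simp only [ImpreciseMarkov.lowerExp_hit A h𝒯 hQ₀, ImpreciseMarkov.upperExp_hit A h𝒯 hQ₀]
  exact ⟨ImpreciseMarkov.tendsto_hitIter h𝒯.isNonexpansive_lowerTrans,
    ImpreciseMarkov.tendsto_hitIter h𝒯.isNonexpansive_upperTrans⟩
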